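/- All graphs are finite and simple; $V_G$ is the vertex set of $G$, $\overline{G}$ is the complement of $G$, and $G[X]$ is the subgraph of $G$ induced by $X\subseteq V_G$. Let $P_5$ be the path on five vertices and $C_5$ the cycle on five vertices. A graph is $\{P_5,\overline{P_5},C_5\}$-free if none of its induced subgraphs is isomorphic to $P_5$, $\overline{P_5}$ or $C_5$. A graph is split if its vertex set can be partitioned into a (possibly empty) clique and a (possibly empty) stable set. A graph $H$ is smaller than $G$ if $|V_H|<|V_G|$. Graphs are considered up to isomorphism. A vertex outside a set $X$, or a set disjoint from $X$, is complete (anti-complete) to $X$ if all (none) of the possible edges between it and $X$ are present. Substitution. Let $G_1,G_2$ be graphs with disjoint vertex sets and let $u\in V_{G_2}$. The graph obtained by substituting $G_1$ for $u$ in $G_2$ is the graph $G$ on $V_{G_1}\cup(V_{G_2}\smallsetminus\{u\})$ such that $G[V_{G_1}]=G_1$, $G[V_{G_2}\smallsetminus\{u\}]=G_2\smallsetminus u$, and each $v\in V_{G_2}\smallsetminus\{u\}$ is complete to $V_{G_1}$ in $G$ if $v$ is adjacent to $u$ in $G_2$, and anti-complete to $V_{G_1}$ otherwise. A graph is obtained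 by substitution from graphs with a property if it arises in this way from some $G_1$, $G_2$, $u$ such that both $G_1$ and $G_2$ have the property. Split graph unification. Let $A,B,C,L,T$ be pairwise disjoint finite sets with $A$ and $C$ non-empty, and let $a\neq c$ be two vertices outside $A\cup B\cup C\cup L\cup T$. A pair of graphs $(G_1,G_2)$ with $V_{G_1}=A\cup L\cup T\cup\{c\}$ and $V_{G_2}=B\cup C\cup L\cup T\cup\{a\}$ is composable (with respect to $A,B,C,L,T,a,c$) if - in $G_1$: $L$ is a (possibly empty) clique, $T$ is a (possibly empty) stable set, $A$ is anti-complete to $T$, and $c$ is complete to $L$ and anti-complete to $A\cup T$; - in $G_2$: $G_2[L\cup T]=G_1[L\cup T]$, $T$ is anti-complete to $C$, $L$ is complete to $B\cup C$, and $a$ is complete to $B$ and anti-complete to $C\cup L\cup T$. The split graph unification of such a pair is the graph $G$ on $A\cup B\cup C\cup L\cup T$ with $G[A\cup L\cup T]=G_1\smallsetminus c$, $G[B\cup C\cup L\cup T]=G_2\smallsetminus a$, and $A$ complete to $B$ and anti-complete to $C$. A graph is obtained by split graph unification from graphs with a property if it is the split graph unification of a composable pair $(G_1,G_2)$ such that both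 $G_1$ and $G_2$ have the property. **Theorem.** A graph $G$ is $\{P_5,\overline{P_5},C_5\}$-free if and only if at least one of the following holds: - $G$ is a split graph; - $G$ is obtained by substitution from $\{P_5,\overline{P_5},C_5\}$-free graphs smaller than $G$; - $G$ or $\overline{G}$ is obtained by split graph unification from $\{P_5,\overline{P_5},C_5\}$-free graphs smaller than $G$. -/

import Mathlib

universe u

open SimpleGraph

/-- `G` contains no induced copy of the four-edge path `P₅`, of its complement, or of the
five-cycle `C₅`. -/
def IsP5HouseC5Free {V : Type u} (G : SimpleGraph V) : Prop :=
  ¬ (pathGraph 5).IsIndContained G ∧ ¬ (pathGraph 5)ᶜ.IsIndContained G ∧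
    ¬ (cycleGraph 5).IsIndContained G

/-- `G` is a split graph: its vertex set can be partitioned into a (possibly empty) clique and a
(possibly empty) stable set. -/
def IsSplitGraph {V : Type u} (G : SimpleGraph V) : Prop :=
  ∃ K S : Set V, K ∪ S = Set.univ ∧ Disjoint K S ∧ G.IsClique K ∧ G.IsIndepSet S

/-- `H` has strictly fewer vertices than `G` (used for finite graphs only). -/
def IsSmallerThan {W V : Type u} (_H : SimpleGraph W) (_G : SimpleGraph V) : Prop :=
  Nat.card W < Nat.card V

/-- The graph obtained by substituting `G₁` for the vertex `u` in `G₂`. -/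
def substituteGraph {V₁ V₂ : Type u} (G₁ : SimpleGraph V₁) (G₂ : SimpleGraph V₂) (u : V₂) :
    SimpleGraph (V₁ ⊕ {v : V₂ // v ≠ u}) where
  Adj
    | .inl x, .inl y => G₁.Adj x y
    | .inr v, .inr w => G₂.Adj v.1 w.1
    | .inl _, .inr v => G₂.Adj v.1 u
    | .inr v, .inl _ => G₂.Adj v.1 u
  symm := ⟨by
    rintro (x | x) (y | y) h
    · exact G₁.adj_symm h
    · exact h
    · exact h
    · exact G₂.adj_symm h⟩
  loopless := ⟨by
    rintro (x | x) h
    · exact G₁.irrefl h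
    · exact G₂.irrefl h⟩

/-- `G` is (up to isomorphism) obtained by substituting a finite graph with property `P` for a
vertex of another finite graph with property `P`. -/
def IsObtainedBySubstitution (P : ∀ {W : Type u}, SimpleGraph W → Prop)
    {V : Type u} (G : SimpleGraph V) : Prop :=
  ∃ (V₁ V₂ : Type u) (_ : Finite V₁) (_ : Finite V₂)
    (G₁ : SimpleGraph V₁) (G₂ : SimpleGraph V₂) (u : V₂),
    P G₁ ∧ P G₂ ∧ Nonempty (G ≃g substituteGraph G₁ G₂ u)

/-- The vertex set `A ∪ L ∪ T ∪ {c}` (disjoint union) of the first graph of a composable pair. -/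
inductive FirstVertex (A L T : Type u) : Type u
  | inA : A → FirstVertex A L T
  | inL : L → FirstVertex A L T
  | inT : T → FirstVertex A L T
  | c : FirstVertex A L T

/-- The vertex set `B ∪ C ∪ L ∪ T ∪ {a}` (disjoint union) of the second graph of a composable
pair. -/
inductive SecondVertex (B C L T : Type u) : Type u
  | inB : B → SecondVertex B C L T
  | inC : C → SecondVertex B C L T
  | inL : L → SecondVertex B C L T
  | inT : T → SecondVertex B C L T
  | a : SecondVertex B C L T

/-- The vertex set `A ∪ B ∪ C ∪ L ∪ T` (disjoint union) of a split graph unification. -/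
inductive UnificationVertex (A B C L T : Type u) : Type u
  | inA : A → UnificationVertex A B C L T
  | inB : B → UnificationVertex A B C L T
  | inC : C → UnificationVertex A B C L T
  | inL : L → UnificationVertex A B C L T
  | inT : T → UnificationVertex A B C L T

/-- `(G₁, G₂)` is a composable pair. -/
structure IsComposablePair {A B C L T : Type u}
    (G₁ : SimpleGraph (FirstVertex A L T)) (G₂ : SimpleGraph (SecondVertex B C L T)) : Prop where
  nonempty_A : Nonempty A
  nonempty_C : Nonempty C
  L_clique : ∀ l l' : L, l ≠ l' → G₁.Adj (.inL l) (.inL l')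
  T_stable : ∀ t t' : T, ¬ G₁.Adj (.inT t) (.inT t')
  A_anticomplete_T : ∀ (x : A) (t : T), ¬ G₁.Adj (.inA x) (.inT t)
  c_complete_L : ∀ l : L, G₁.Adj .c (.inL l)
  c_anticomplete_A : ∀ x : A, ¬ G₁.Adj .c (.inA x)
  c_anticomplete_T : ∀ t : T, ¬ G₁.Adj .c (.inT t)
  /-- `G₂[L ∪ T] = G₁[L ∪ T]` -/
  induce_eq : G₂.comap (Sum.elim SecondVertex.inL SecondVertex.inT : L ⊕ T → _) =
    G₁.comap (Sum.elim FirstVertex.inL FirstVertex.inT : L ⊕ T → _)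
  T_anticomplete_C : ∀ (t : T) (z : C), ¬ G₂.Adj (.inT t) (.inC z)
  L_complete_B : ∀ (l : L) (y : B), G₂.Adj (.inL l) (.inB y)
  L_complete_C : ∀ (l : L) (z : C), G₂.Adj (.inL l) (.inC z)
  a_complete_B : ∀ y : B, G₂.Adj .a (.inB y)
  a_anticomplete_C : ∀ z : C, ¬ G₂.Adj .a (.inC z)
  a_anticomplete_L : ∀ l : L, ¬ G₂.Adj .a (.inL l)
  a_anticomplete_T : ∀ t : T, ¬ G₂.Adj .a (.inT t)

/-- `G` is the split graph unification of `(G₁, G₂)`: its restriction to `A ∪ L ∪ T` is `G₁` minus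
`c`, its restriction to `B ∪ C ∪ L ∪ T` is `G₂` minus `a`, and `A` is complete to `B` and
anti-complete to `C`. -/
structure IsSplitGraphUnification {A B C L T : Type u}
    (G₁ : SimpleGraph (FirstVertex A L T)) (G₂ : SimpleGraph (SecondVertex B C L T))
    (G : SimpleGraph (UnificationVertex A B C L T)) : Prop where
  induce_ALT :
    G.comap (Sum.elim UnificationVertex.inA
      (Sum.elim UnificationVertex.inL UnificationVertex.inT) : A ⊕ L ⊕ T → _) =
    G₁.comap (Sum.elim FirstVertex.inA (Sum.elim FirstVertex.inL FirstVertex.inT))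
  induce_BCLT :
    G.comap (Sum.elim UnificationVertex.inB (Sum.elim UnificationVertex.inC
      (Sum.elim UnificationVertex.inL UnificationVertex.inT)) : B ⊕ C ⊕ L ⊕ T → _) =
    G₂.comap (Sum.elim SecondVertex.inB (Sum.elim SecondVertex.inC
      (Sum.elim SecondVertex.inL SecondVertex.inT)))
  A_complete_B : ∀ (x : A) (y : B), G.Adj (.inA x) (.inB y)
  A_anticomplete_C : ∀ (x : A) (z : C), ¬ G.Adj (.inA x) (.inC z)

/-- `G` is (up to isomorphism) the split graph unification of a composable pair of finite graphs
both of which have property `P`. -/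
def IsObtainedBySplitGraphUnification (P : ∀ {W : Type u}, SimpleGraph W → Prop)
    {V : Type u} (G : SimpleGraph V) : Prop :=
  ∃ (A B C L T : Type u) (_ : Finite A) (_ : Finite B) (_ : Finite C) (_ : Finite L)
    (_ : Finite T) (G₁ : SimpleGraph (FirstVertex A L T))
    (G₂ : SimpleGraph (SecondVertex B C L T))
    (H : SimpleGraph (UnificationVertex A B C L T)),
    IsComposablePair G₁ G₂ ∧ P G₁ ∧ P G₂ ∧ IsSplitGraphUnification G₁ G₂ H ∧ Nonempty (G ≃g H)

/-!
The argument has two halves.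

For the converse direction, each of `P₅`, the house and `C₅` is prime
(`subsingleton_or_forall_or_exists_mixed`), so none of them can be created by substitution, and none
of them is split. For split graph unification, label the vertices of an induced obstruction by the
five parts. A finite check (`IsDivision.obstruction`) shows that either `B` is not used and `C` at
most once, and then the obstruction already lies in the first graph, or `A` is used at most once, by
a vertex without neighbours in `L`, and then it already lies in the second graph. The class is closed
under complements because `C₅` is self-complementary.

For the direct direction, a free graph that is not split contains an induced `2K₂` or `C₄`
(`isSplitGraph_of_forall`), so `G` or its complement has a separated core: a connected set `A` of at
least two vertices that is anticomplete to some edge (`IsSeparatedCore`). Take `A` of maximum size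
over `G` and its complement, say in `G`, and let `D` be a component, containing an edge, of the
subgraph far from `A`. By maximality, every vertex of `N = N(A)` meets every edge far from `A`.
Let `L` be the set of vertices of `N` that are mixed on `D`. Excluding `P₅` shows that `L` is
complete to `A` and to every other edge far from `A`; excluding the house shows that `L` is complete
to `N \ L`. Two nonadjacent vertices of `L` would have a common neighbour `c` in `D`, and then
`A ∪ {c}` would be a larger separated core of the complement, so `L` is a clique. Hence `D`,
`N \ L`, the nonisolated far vertices together with `A`, the set `L`, and the isolated far vertices
are the parts `A`, `B`, `C`, `L`, `T` of a split graph unification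
(`IsSeparatedCore.exists_divide`). The first graph is an induced subgraph of `G`; the second one is
free because every vertex of `L` has a nonneighbour in `D`
(`IsDivision.isP5HouseC5Free_secondGraph`). Substitution is not needed in this direction.
-/

/-! ### The three five-vertex obstructions -/

/-- The three forbidden induced subgraphs `P₅`, its complement (the house) and `C₅`. -/
def fiveVertexObstructions : Set (SimpleGraph (Fin 5)) :=
  {pathGraph 5, (pathGraph 5)ᶜ, cycleGraph 5}

theorem isP5HouseC5Free_iff {V : Type u} {G : SimpleGraph V} :
    IsP5HouseC5Free G ↔ ∀ H ∈ fiveVertexObstructions, ¬ H.IsIndContained G := by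
  simp [IsP5HouseC5Free, fiveVertexObstructions]

theorem cycleGraph_five_adj : ∀ i j : Fin 5, (cycleGraph 5).Adj i j ↔ i + 1 = j ∨ j + 1 = i := by
  decide

namespace FiveVertexSubset

/-- Universal quantification over `Bool`, in a form that the kernel evaluates cheaply. -/
def all (f : Bool → Bool) : Bool := f true && f false

theorem all_eq_true {f : Bool → Bool} (h : all f = true) (b : Bool) : f b = true := by
  simp only [all, Bool.and_eq_true] at h
  cases b
  exacts [h.2, h.1]

/-- For a vertex `v` and the four other vertices `wᵢ`, with `b` and `bᵢ` telling whether `v` and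
`wᵢ` belong to a set and `eᵢ` whether `v` is adjacent to `wᵢ`: `v` lies outside the set and has both
a neighbour and a nonneighbour in it. -/
def mixed (b b₁ e₁ b₂ e₂ b₃ e₃ b₄ e₄ : Bool) : Bool :=
  !b && ((b₁ && e₁ || (b₂ && e₂ || (b₃ && e₃ || b₄ && e₄))) &&
    (b₁ && !e₁ || (b₂ && !e₂ || (b₃ && !e₃ || b₄ && !e₄))))

/-- At most one of the five Booleans is `true`. -/
def atMostOne (b0 b1 b2 b3 b4 : Bool) : Bool :=
  bif b0 then !b1 && (!b2 && (!b3 && !b4))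
  else bif b1 then !b2 && (!b3 && !b4)
  else bif b2 then !b3 && !b4
  else !b3 || !b4

theorem atMostOne_eq_true {s : Fin 5 → Prop} [DecidablePred s] :
    atMostOne (decide (s 0)) (decide (s 1)) (decide (s 2)) (decide (s 3)) (decide (s 4)) = true ↔
      ∀ i j, s i → s j → i = j := by
  simp only [Fin.forall_fin_succ, Fin.succ_zero_eq_one, Fin.succ_one_eq_two, IsEmpty.forall_iff,
    and_true]
  change _ ↔ (((s 0 → s 0 → True) ∧ (s 0 → s 1 → _) ∧ (s 0 → s 2 → _) ∧ (s 0 → s 3 → _) ∧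
    (s 0 → s 4 → _)) ∧ ((s 1 → s 0 → _) ∧ (s 1 → s 1 → True) ∧ (s 1 → s 2 → _) ∧ (s 1 → s 3 → _) ∧
    (s 1 → s 4 → _)) ∧ ((s 2 → s 0 → _) ∧ (s 2 → s 1 → _) ∧ (s 2 → s 2 → True) ∧ (s 2 → s 3 → _) ∧
    (s 2 → s 4 → _)) ∧ ((s 3 → s 0 → _) ∧ (s 3 → s 1 → _) ∧ (s 3 → s 2 → _) ∧ (s 3 → s 3 → True) ∧
    (s 3 → s 4 → _)) ∧ (s 4 → s 0 → _) ∧ (s 4 → s 1 → _) ∧ (s 4 → s 2 → _) ∧ (s 4 → s 3 → _) ∧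
    (s 4 → s 4 → True))
  by_cases h0 : s 0 <;> by_cases h1 : s 1 <;> by_cases h2 : s 2 <;> by_cases h3 : s 3 <;>
    by_cases h4 : s 4 <;> simp [h0, h1, h2, h3, h4, atMostOne, Fin.ext_iff]

theorem exists_of_mixed {H : SimpleGraph (Fin 5)} [DecidableRel H.Adj] {s : Fin 5 → Prop}
    [DecidablePred s] {v w₁ w₂ w₃ w₄ : Fin 5}
    (h : mixed (decide (s v)) (decide (s w₁)) (decide (H.Adj v w₁)) (decide (s w₂))
      (decide (H.Adj v w₂)) (decide (s w₃)) (decide (H.Adj v w₃)) (decide (s w₄))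
      (decide (H.Adj v w₄)) = true) :
    ∃ v x y, ¬ s v ∧ s x ∧ s y ∧ H.Adj v x ∧ ¬ H.Adj v y := by
  simp only [mixed, Bool.and_eq_true, Bool.or_eq_true, Bool.not_eq_true', decide_eq_true_eq,
    decide_eq_false_iff_not] at h
  obtain ⟨hv, hx, hy⟩ := h
  obtain ⟨x, hx, hvx⟩ : ∃ x, s x ∧ H.Adj v x := by
    rcases hx with h | h | h | h <;> exact ⟨_, h⟩
  obtain ⟨y, hy, hvy⟩ : ∃ y, s y ∧ ¬ H.Adj v y := by
    rcases hy with h | h | h | h <;> exact ⟨_, h⟩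
  exact ⟨v, x, y, hv, hx, hy, hvx, hvy⟩

/-- The graph on `Fin 5` whose edges are given by the Booleans `eij` is prime: every set of at least
two but not all vertices has a vertex outside it that is mixed on it. -/
def primeCheck (e01 e02 e12 e03 e13 e23 e04 e14 e24 e34 : Bool) : Bool :=
  all fun b0 => all fun b1 => all fun b2 => all fun b3 => all fun b4 =>
    atMostOne b0 b1 b2 b3 b4 || (b0 && (b1 && (b2 && (b3 && b4))) ||
    (mixed b0 b1 e01 b2 e02 b3 e03 b4 e04 || (mixed b1 b0 e01 b2 e12 b3 e13 b4 e14 ||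
    (mixed b2 b0 e02 b1 e12 b3 e23 b4 e24 || (mixed b3 b0 e03 b1 e13 b2 e23 b4 e34 ||
    mixed b4 b0 e04 b1 e14 b2 e24 b3 e34)))))

theorem primeCheck_path :
    primeCheck true false true false false true false false false true = true := by
  decide +kernel

theorem primeCheck_house :
    primeCheck false true false true true false true true true false = true := by
  decide +kernel

theorem primeCheck_cycle :
    primeCheck true false true false false true true false false true = true := by
  decide +kernel

end FiveVertexSubset

/-- The obstructions are prime: a set of vertices with no mixed vertex outside it is trivial. -/
theorem subsingleton_or_forall_or_exists_mixed {H : SimpleGraph (Fin 5)}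
    (hH : H ∈ fiveVertexObstructions) (s : Fin 5 → Prop) :
    (∀ i j, s i → s j → i = j) ∨ (∀ i, s i) ∨
      ∃ v x y, ¬ s v ∧ s x ∧ s y ∧ H.Adj v x ∧ ¬ H.Adj v y := by
  classical
  have key : FiveVertexSubset.primeCheck (decide (H.Adj 0 1)) (decide (H.Adj 0 2))
      (decide (H.Adj 1 2)) (decide (H.Adj 0 3)) (decide (H.Adj 1 3)) (decide (H.Adj 2 3))
      (decide (H.Adj 0 4)) (decide (H.Adj 1 4)) (decide (H.Adj 2 4)) (decide (H.Adj 3 4)) =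
        true := by
    rcases hH with rfl | rfl | rfl
    · simpa [pathGraph_adj] using FiveVertexSubset.primeCheck_path
    · simpa [pathGraph_adj] using FiveVertexSubset.primeCheck_house
    · simpa [cycleGraph_five_adj] using FiveVertexSubset.primeCheck_cycle
  rw [FiveVertexSubset.primeCheck] at key
  replace key := FiveVertexSubset.all_eq_true (FiveVertexSubset.all_eq_true
    (FiveVertexSubset.all_eq_true (FiveVertexSubset.all_eq_true (FiveVertexSubset.all_eq_true key
    (decide (s 0))) (decide (s 1))) (decide (s 2))) (decide (s 3))) (decide (s 4))
  simp only [Bool.or_eq_true] at key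
  rcases key with h | h | h | h | h | h | h
  · exact .inl (FiveVertexSubset.atMostOne_eq_true.1 h)
  · refine .inr (.inl ?_)
    simpa [Fin.forall_fin_succ] using h
  · exact .inr (.inr (FiveVertexSubset.exists_of_mixed h))
  · simp only [H.adj_comm 0 1] at h
    exact .inr (.inr (FiveVertexSubset.exists_of_mixed h))
  · simp only [H.adj_comm 0 2, H.adj_comm 1 2] at h
    exact .inr (.inr (FiveVertexSubset.exists_of_mixed h))
  · simp only [H.adj_comm 0 3, H.adj_comm 1 3, H.adj_comm 2 3] at h
    exact .inr (.inr (FiveVertexSubset.exists_of_mixed h))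
  · simp only [H.adj_comm 0 4, H.adj_comm 1 4, H.adj_comm 2 4, H.adj_comm 3 4] at h
    exact .inr (.inr (FiveVertexSubset.exists_of_mixed h))

/-- The obstructions are not split graphs. -/
theorem exists_not_split {H : SimpleGraph (Fin 5)} (hH : H ∈ fiveVertexObstructions)
    (s : Fin 5 → Prop) :
    ∃ i j, (s i ∧ s j ∧ i ≠ j ∧ ¬ H.Adj i j) ∨ (¬ s i ∧ ¬ s j ∧ H.Adj i j) := by
  by_contra! h
  rcases hH with rfl | rfl | rfl
  · have h01 := h 0 1
    have h34 := h 3 4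
    have h03 := h 0 3
    have h04 := h 0 4
    have h13 := h 1 3
    have h14 := h 1 4
    simp [pathGraph_adj] at h01 h34 h03 h04 h13 h14
    tauto
  · have h01 := h 0 1
    have h34 := h 3 4
    have h03 := h 0 3
    have h04 := h 0 4
    have h13 := h 1 3
    have h14 := h 1 4
    simp [pathGraph_adj] at h01 h34 h03 h04 h13 h14
    tauto
  · have h01 := h 0 1
    have h02 := h 0 2
    have h23 := h 2 3
    have h30 := h 3 0
    have h40 := h 4 0
    have h41 := h 4 1
    simp [cycleGraph_five_adj] at h01 h02 h23 h30 h40 h41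
    by_cases h0 : s 0
    · exact h30 (h23 (h02 h0)) h0
    · exact h41 (by_contra fun h4 => h0 (h40 h4)) (h01 h0)

/-- A map that preserves and reflects adjacency is automatically injective on an obstruction, since
no two vertices of an obstruction are twins. -/
theorem IsP5HouseC5Free.false_of_adj_iff {V : Type u} {G : SimpleGraph V}
    (hG : IsP5HouseC5Free G) {H : SimpleGraph (Fin 5)} (hH : H ∈ fiveVertexObstructions)
    (f : Fin 5 → V) (h : ∀ i j, G.Adj (f i) (f j) ↔ H.Adj i j) : False := by
  refine isP5HouseC5Free_iff.1 hG H hH ⟨⟨⟨f, fun i j hij => ?_⟩, h _ _⟩⟩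
  obtain h1 | h1 | ⟨v, x, y, -, rfl | rfl, rfl | rfl, hvx, hvy⟩ :=
    subsingleton_or_forall_or_exists_mixed hH (fun k => k = i ∨ k = j)
  · exact h1 i j (.inl rfl) (.inr rfl)
  · have key : ∀ i j : Fin 5, ∃ k, ¬ (k = i ∨ k = j) := by decide
    obtain ⟨k, hk⟩ := key i j
    exact (hk (h1 k)).elim
  all_goals
    rw [← h] at hvx hvy
    first
    | exact absurd hvx hvy
    | exact absurd hvx (hij ▸ hvy)

/-- The path is `a b c d e`. -/
theorem IsP5HouseC5Free.false_of_path {V : Type u} {G : SimpleGraph V} (hG : IsP5HouseC5Free G)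
    {a b c d e : V} (hab : G.Adj a b) (hbc : G.Adj b c) (hcd : G.Adj c d) (hde : G.Adj d e)
    (hac : ¬ G.Adj a c) (had : ¬ G.Adj a d) (hae : ¬ G.Adj a e) (hbd : ¬ G.Adj b d)
    (hbe : ¬ G.Adj b e) (hce : ¬ G.Adj c e) : False := by
  refine hG.false_of_adj_iff (H := pathGraph 5) (by simp [fiveVertexObstructions])
    ![a, b, c, d, e] fun i j => ?_
  fin_cases i <;> fin_cases j <;> simp [pathGraph_adj, G.adj_comm, *]

/-- The house is given by the path `a b c d e` of its complement. -/
theorem IsP5HouseC5Free.false_of_house {V : Type u} {G : SimpleGraph V} (hG : IsP5HouseC5Free G)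
    {a b c d e : V} (hab : ¬ G.Adj a b) (hbc : ¬ G.Adj b c) (hcd : ¬ G.Adj c d)
    (hde : ¬ G.Adj d e) (hac : G.Adj a c) (had : G.Adj a d) (hae : G.Adj a e) (hbd : G.Adj b d)
    (hbe : G.Adj b e) (hce : G.Adj c e) : False := by
  refine hG.false_of_adj_iff (H := (pathGraph 5)ᶜ) (by simp [fiveVertexObstructions])
    ![a, b, c, d, e] fun i j => ?_
  fin_cases i <;> fin_cases j <;> simp [pathGraph_adj, G.adj_comm, *]

theorem IsP5HouseC5Free.false_of_cycle {V : Type u} {G : SimpleGraph V} (hG : IsP5HouseC5Free G)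
    {a b c d e : V} (hab : G.Adj a b) (hbc : G.Adj b c) (hcd : G.Adj c d) (hde : G.Adj d e)
    (hea : G.Adj e a) (hac : ¬ G.Adj a c) (had : ¬ G.Adj a d) (hbd : ¬ G.Adj b d)
    (hbe : ¬ G.Adj b e) (hce : ¬ G.Adj c e) : False := by
  refine hG.false_of_adj_iff (H := cycleGraph 5) (by simp [fiveVertexObstructions])
    ![a, b, c, d, e] fun i j => ?_
  have hae := hea.symm
  rw [cycleGraph_five_adj]
  fin_cases i <;> fin_cases j <;> simp [G.adj_comm, *]

theorem IsP5HouseC5Free.of_embedding {V W : Type u} {G : SimpleGraph V} {G' : SimpleGraph W}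
    (hG : IsP5HouseC5Free G) (f : G' ↪g G) : IsP5HouseC5Free G' := by
  rw [isP5HouseC5Free_iff] at hG ⊢
  exact fun H hH ⟨g⟩ => hG H hH ⟨f.comp g⟩

theorem IsP5HouseC5Free.compl {V : Type u} {G : SimpleGraph V} (hG : IsP5HouseC5Free G) :
    IsP5HouseC5Free Gᶜ := by
  obtain ⟨h1, h2, h3⟩ := hG
  refine ⟨fun ⟨f⟩ => h2 ⟨?_⟩, fun ⟨f⟩ => h1 ⟨?_⟩, fun ⟨f⟩ => h3 ⟨?_⟩⟩
  · simpa using SimpleGraph.Embedding.complEquiv f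
  · exact SimpleGraph.Embedding.complEquiv.symm f
  · -- The complement of `C₅` is again a `C₅`, via doubling on `ℤ/5`.
    have e : (cycleGraph 5)ᶜ ↪g cycleGraph 5 :=
      ⟨⟨fun i => 2 * i, by decide⟩, by
        intro a b
        simp only [compl_adj, cycleGraph_five_adj, Function.Embedding.coeFn_mk]
        revert a b
        decide⟩
    exact SimpleGraph.Embedding.complEquiv.symm (f.comp e)

/-! ### Divisions into the five parts of a split graph unification -/

/-- The names of the five parts of the vertex set of a split graph unification. -/
inductive DividePart
  | A | B | C | L | T
  deriving DecidableEq

namespace DividePart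

/-- The pairs of parts, in either order, between which a division has all edges; the pair `L`, `L`
expresses that `L` is a clique. -/
def forcesAdj : DividePart → DividePart → Bool
  | A, B | B, A | L, L | L, B | B, L | L, C | C, L => true
  | _, _ => false

/-- The pairs of parts, in either order, between which a division has no edges; the pair `T`, `T`
expresses that `T` is stable. -/
def forcesNonadj : DividePart → DividePart → Bool
  | A, C | C, A | A, T | T, A | T, T | T, C | C, T => true
  | _, _ => false

/-- Vertices in the parts `p` and `q` may be adjacent (`b = true`), or nonadjacent (`b = false`). -/
def compatible (p : DividePart) (b : Bool) (q : DividePart) : Bool :=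
  bif b then !forcesNonadj p q else !forcesAdj p q

end DividePart

/-- The labelling `t` divides the vertices of `G` into parts `A`, `B`, `C`, `L`, `T` that satisfy the
adjacency conditions of a split graph unification; parts may be empty. -/
structure IsDivision {V : Type*} (G : SimpleGraph V) (t : V → DividePart) : Prop where
  adj : ∀ x y, x ≠ y → (t x).forcesAdj (t y) = true → G.Adj x y
  not_adj : ∀ x y, (t x).forcesNonadj (t y) = true → ¬ G.Adj x y

theorem IsDivision.comap {V W : Type*} {G : SimpleGraph V} {H : SimpleGraph W} {t : V → DividePart}
    (h : IsDivision G t) (f : H ↪g G) : IsDivision H (t ∘ f) :=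
  ⟨fun _ _ hxy hp => f.map_adj_iff.1 (h.adj _ _ (f.injective.ne hxy) hp),
    fun _ _ hp hadj => h.not_adj _ _ hp (f.map_adj_iff.2 hadj)⟩

/-- Boolean quantifier over the five parts, which the kernel evaluates cheaply. -/
def DividePart.all (f : DividePart → Bool) : Bool := f .A && (f .B && (f .C && (f .L && f .T)))

theorem DividePart.all_eq_true {f : DividePart → Bool} (h : DividePart.all f = true)
    (p : DividePart) : f p = true := by
  simp only [DividePart.all, Bool.and_eq_true] at h
  cases p <;> simp [h]

/-- Boolean equality of parts, defined by matching so that the kernel evaluates it cheaply. -/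
def DividePart.beq : DividePart → DividePart → Bool
  | A, A | B, B | C, C | L, L | T, T => true
  | _, _ => false

theorem DividePart.beq_eq_true {p q : DividePart} : p.beq q = true ↔ p = q := by
  cases p <;> cases q <;> simp [DividePart.beq]

namespace FiveParts

/-- None of the five labels is `p`. -/
def absent (p p0 p1 p2 p3 p4 : DividePart) : Bool :=
  !p0.beq p && (!p1.beq p && (!p2.beq p && (!p3.beq p && !p4.beq p)))

/-- At most one of the five labels is `p`. -/
def atMostOne (p p0 p1 p2 p3 p4 : DividePart) : Bool :=
  bif p0.beq p then !p1.beq p && (!p2.beq p && (!p3.beq p && !p4.beq p))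
  else bif p1.beq p then !p2.beq p && (!p3.beq p && !p4.beq p)
  else bif p2.beq p then !p3.beq p && !p4.beq p
  else !p3.beq p || !p4.beq p

/-- There is an edge between the part `A` and the part `L`. -/
def edgeAL (b : Bool) (p q : DividePart) : Bool :=
  b && ((p.beq .A && q.beq .L) || (p.beq .L && q.beq .A))

/-- The conclusion of `IsDivision.obstruction` for the graph on `Fin 5` with edges `bij` and labels
`pi`. -/
def good (b01 b02 b12 b03 b13 b23 b04 b14 b24 b34 : Bool) (p0 p1 p2 p3 p4 : DividePart) : Bool :=
  bif atMostOne .A p0 p1 p2 p3 p4 && (!edgeAL b01 p0 p1 && (!edgeAL b02 p0 p2 &&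
      (!edgeAL b12 p1 p2 && (!edgeAL b03 p0 p3 && (!edgeAL b13 p1 p3 && (!edgeAL b23 p2 p3 &&
      (!edgeAL b04 p0 p4 && (!edgeAL b14 p1 p4 && (!edgeAL b24 p2 p4 && !edgeAL b34 p3 p4)))))))))
  then absent .A p0 p1 p2 p3 p4 || atMostOne .L p0 p1 p2 p3 p4
  else absent .B p0 p1 p2 p3 p4 && atMostOne .C p0 p1 p2 p3 p4

/-- Every labelling of the graph on `Fin 5` with edges `bij` is good, if it is a division. A partial
labelling that already violates the conditions of a division is not extended further. -/
def allGood (b01 b02 b12 b03 b13 b23 b04 b14 b24 b34 : Bool) : Bool :=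
  DividePart.all fun p0 => DividePart.all fun p1 =>
  bif p0.compatible b01 p1 then DividePart.all fun p2 =>
  bif p0.compatible b02 p2 && p1.compatible b12 p2 then DividePart.all fun p3 =>
  bif p0.compatible b03 p3 && (p1.compatible b13 p3 && p2.compatible b23 p3) then
  DividePart.all fun p4 =>
  bif p0.compatible b04 p4 && (p1.compatible b14 p4 && (p2.compatible b24 p4 &&
    p3.compatible b34 p4)) then
  good b01 b02 b12 b03 b13 b23 b04 b14 b24 b34 p0 p1 p2 p3 p4
  else true else true else true else true

theorem allGood_path :
    allGood true false true false false true false false false true = true := by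
  decide +kernel

theorem allGood_house :
    allGood false true false true true false true true true false = true := by
  decide +kernel

theorem allGood_cycle :
    allGood true false true false false true true false false true = true := by
  decide +kernel

end FiveParts

namespace FiveParts

theorem absent_eq_true {p : DividePart} {t : Fin 5 → DividePart} :
    absent p (t 0) (t 1) (t 2) (t 3) (t 4) = true ↔ ∀ i, t i ≠ p := by
  simp only [absent, Bool.and_eq_true, Bool.not_eq_true', ← Bool.not_eq_true,
    DividePart.beq_eq_true, Fin.forall_fin_succ, ne_eq]
  simp

theorem atMostOne_eq_true {p : DividePart} {t : Fin 5 → DividePart} :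
    atMostOne p (t 0) (t 1) (t 2) (t 3) (t 4) = true ↔ ∀ i j, t i = p → t j = p → i = j := by
  simp only [atMostOne, Fin.forall_fin_succ, ← DividePart.beq_eq_true]
  simp only [Fin.succ_zero_eq_one, Fin.succ_one_eq_two, IsEmpty.forall_iff, and_true]
  generalize h0 : (t 0).beq p = x0, h1 : (t 1).beq p = x1, h2 : (t 2).beq p = x2
  generalize h3 : (t (Fin.succ 2)).beq p = x3, h4 : (t (Fin.succ (Fin.succ 2))).beq p = x4
  have h3' : (t 3).beq p = x3 := h3
  have h4' : (t 4).beq p = x4 := h4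
  rw [h3', h4']
  clear h0 h1 h2 h3 h4 h3' h4'
  cases x0 <;> cases x1 <;> cases x2 <;> cases x3 <;> cases x4 <;> simp [Fin.ext_iff]

end FiveParts

/-- How the three obstructions can be divided. In the first case the part `A` is at most a single
vertex without neighbours in `L`, as in the second graph of a composable pair. In the second case
`B` is empty and `C` is at most a single vertex, as in the first graph. The additional statement in
the first case serves to compare the second graph with a subgraph of the whole graph. -/
theorem IsDivision.obstruction {H : SimpleGraph (Fin 5)} (hH : H ∈ fiveVertexObstructions)
    {t : Fin 5 → DividePart} (ht : IsDivision H t) :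
    ((∀ i j, t i = .A → t j = .A → i = j) ∧ (∀ i j, t i = .A → t j = .L → ¬ H.Adj i j) ∧
      ((∀ i, t i ≠ .A) ∨ ∀ i j, t i = .L → t j = .L → i = j)) ∨
    ((∀ i, t i ≠ .B) ∧ ∀ i j, t i = .C → t j = .C → i = j) := by
  classical
  have hc : ∀ i j, i ≠ j → (t i).compatible (decide (H.Adj i j)) (t j) = true := by
    intro i j hij
    have h1 := ht.adj i j hij
    have h2 := ht.not_adj i j
    by_cases hb : H.Adj i j <;> simp_all [DividePart.compatible]
  have key : FiveParts.allGood (decide (H.Adj 0 1)) (decide (H.Adj 0 2)) (decide (H.Adj 1 2))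
      (decide (H.Adj 0 3)) (decide (H.Adj 1 3)) (decide (H.Adj 2 3)) (decide (H.Adj 0 4))
      (decide (H.Adj 1 4)) (decide (H.Adj 2 4)) (decide (H.Adj 3 4)) = true := by
    rcases hH with rfl | rfl | rfl
    · simpa [pathGraph_adj] using FiveParts.allGood_path
    · simpa [pathGraph_adj] using FiveParts.allGood_house
    · simpa [cycleGraph_five_adj] using FiveParts.allGood_cycle
  rw [FiveParts.allGood] at key
  replace key := DividePart.all_eq_true (DividePart.all_eq_true key (t 0)) (t 1)
  simp only [hc 0 1 (by decide), cond_true] at key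
  replace key := DividePart.all_eq_true key (t 2)
  simp only [hc 0 2 (by decide), hc 1 2 (by decide), Bool.and_true, cond_true] at key
  replace key := DividePart.all_eq_true key (t 3)
  simp only [hc 0 3 (by decide), hc 1 3 (by decide), hc 2 3 (by decide), Bool.and_true,
    cond_true] at key
  replace key := DividePart.all_eq_true key (t 4)
  simp only [hc 0 4 (by decide), hc 1 4 (by decide), hc 2 4 (by decide), hc 3 4 (by decide),
    Bool.and_true, cond_true] at key
  rw [FiveParts.good, Bool.cond_eq_ite] at key
  split_ifs at key with h
  · left
    rw [Bool.and_eq_true, FiveParts.atMostOne_eq_true] at h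
    rw [Bool.or_eq_true, FiveParts.atMostOne_eq_true, FiveParts.absent_eq_true] at key
    refine ⟨h.1, ?_, key⟩
    have h2 := h.2
    simp only [FiveParts.edgeAL, Bool.and_eq_true, Bool.not_eq_true', ← Bool.not_eq_true,
      Bool.or_eq_true, DividePart.beq_eq_true, decide_eq_true_eq] at h2
    intro i j hi hj hij
    fin_cases i <;> fin_cases j <;>
      simp only [Fin.isValue, Fin.zero_eta, Fin.mk_one, Fin.reduceFinMk] at hi hj hij <;>
      first
      | exact H.irrefl hij
      | simp [hi, hj, hij, hij.symm] at h2
  · right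
    rwa [Bool.and_eq_true, FiveParts.atMostOne_eq_true, FiveParts.absent_eq_true] at key

/-! ### The operations preserve freeness -/

theorem isP5HouseC5Free_substituteGraph {V₁ V₂ : Type u} {G₁ : SimpleGraph V₁}
    {G₂ : SimpleGraph V₂} (h₁ : IsP5HouseC5Free G₁) (h₂ : IsP5HouseC5Free G₂) (u : V₂) :
    IsP5HouseC5Free (substituteGraph G₁ G₂ u) := by
  rw [isP5HouseC5Free_iff]
  rintro H hH ⟨φ⟩
  have hφ : ∀ i j, (substituteGraph G₁ G₂ u).Adj (φ i) (φ j) ↔ H.Adj i j :=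
    fun i j => φ.map_adj_iff
  -- The vertices of the obstruction in `V₁` form a homogeneous set, which is trivial by primeness.
  rcases subsingleton_or_forall_or_exists_mixed hH (fun i => ∃ x, φ i = .inl x) with
    h | h | ⟨v, x, y, hv, ⟨x', hx⟩, ⟨y', hy⟩, hvx, hvy⟩
  · refine h₂.false_of_adj_iff hH (fun i => Sum.elim (fun _ => u) Subtype.val (φ i))
      fun i j => ?_
    rw [← hφ]
    rcases hi : φ i with x | x <;> rcases hj : φ j with y | y
    · obtain rfl := h i j ⟨x, hi⟩ ⟨y, hj⟩
      rw [← hi, ← hj]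
      simp
    · exact G₂.adj_comm _ _
    · rfl
    · rfl
  · choose f hf using h
    refine h₁.false_of_adj_iff hH f fun i j => ?_
    rw [← hφ, hf, hf]
    rfl
  · rw [← hφ] at hvx hvy
    rcases hv' : φ v with z | z
    · exact hv ⟨z, hv'⟩
    · rw [hv', hx] at hvx
      rw [hv', hy] at hvy
      exact hvy hvx

/-- The part of a vertex of a split graph unification. -/
def UnificationVertex.part {A B C L T : Type u} : UnificationVertex A B C L T → DividePart
  | .inA _ => .A
  | .inB _ => .B
  | .inC _ => .C
  | .inL _ => .L
  | .inT _ => .T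

/-- The map to the first vertex set that collapses `C` to `c`; its value `c` on `B` is arbitrary. -/
def UnificationVertex.toFirst {A B C L T : Type u} :
    UnificationVertex A B C L T → FirstVertex A L T
  | .inA x => .inA x
  | .inB _ => .c
  | .inC _ => .c
  | .inL x => .inL x
  | .inT x => .inT x

/-- The map to the second vertex set that collapses `A` to `a`. -/
def UnificationVertex.toSecond {A B C L T : Type u} :
    UnificationVertex A B C L T → SecondVertex B C L T
  | .inA _ => .a
  | .inB x => .inB x
  | .inC x => .inC x
  | .inL x => .inL x
  | .inT x => .inT x

section Unification

variable {A B C L T : Type u} {G₁ : SimpleGraph (FirstVertex A L T)}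
  {G₂ : SimpleGraph (SecondVertex B C L T)} {G : SimpleGraph (UnificationVertex A B C L T)}

open UnificationVertex

theorem IsSplitGraphUnification.adj_iff_first (h : IsSplitGraphUnification G₁ G₂ G)
    (hc : IsComposablePair G₁ G₂) {x y : UnificationVertex A B C L T} (hx : x.part ≠ .B)
    (hy : y.part ≠ .B) (hxy : ¬ (x.part = .C ∧ y.part = .C)) :
    G.Adj x y ↔ G₁.Adj x.toFirst y.toFirst := by
  have e₁ : ∀ i j : A ⊕ L ⊕ T, G.Adj _ _ ↔ G₁.Adj _ _ := fun i j =>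
    iff_of_eq (congrArg (fun K => K.Adj i j) h.induce_ALT)
  have e₂ : ∀ i j : B ⊕ C ⊕ L ⊕ T, G.Adj _ _ ↔ G₂.Adj _ _ := fun i j =>
    iff_of_eq (congrArg (fun K => K.Adj i j) h.induce_BCLT)
  have hLC : ∀ l z, G.Adj (.inL l) (.inC z) := fun l z =>
    (e₂ (.inr (.inr (.inl l))) (.inr (.inl z))).2 (hc.L_complete_C l z)
  have hTC : ∀ t z, ¬ G.Adj (.inT t) (.inC z) := fun t z hadj =>
    hc.T_anticomplete_C t z ((e₂ (.inr (.inr (.inr t))) (.inr (.inl z))).1 hadj)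
  simp only [Sum.forall, Sum.elim_inl, Sum.elim_inr, forall_and] at e₁
  rcases x with x | x | x | x | x <;> rcases y with y | y | y | y | y <;>
    simp [part, toFirst] at hx hy hxy ⊢ <;>
    simp [e₁, hLC, hTC, h.A_anticomplete_C, hc.c_complete_L, hc.c_anticomplete_A,
      hc.c_anticomplete_T, G.adj_comm (.inC _), G₁.adj_comm _ .c]

theorem IsSplitGraphUnification.adj_iff_second (h : IsSplitGraphUnification G₁ G₂ G)
    (hc : IsComposablePair G₁ G₂) {x y : UnificationVertex A B C L T}
    (hxy : ¬ (x.part = .A ∧ y.part = .A)) (hxL : x.part = .A → y.part = .L → ¬ G.Adj x y)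
    (hLx : y.part = .A → x.part = .L → ¬ G.Adj y x) :
    G.Adj x y ↔ G₂.Adj x.toSecond y.toSecond := by
  have e₁ : ∀ i j : A ⊕ L ⊕ T, G.Adj _ _ ↔ G₁.Adj _ _ := fun i j =>
    iff_of_eq (congrArg (fun K => K.Adj i j) h.induce_ALT)
  have e₂ : ∀ i j : B ⊕ C ⊕ L ⊕ T, G.Adj _ _ ↔ G₂.Adj _ _ := fun i j =>
    iff_of_eq (congrArg (fun K => K.Adj i j) h.induce_BCLT)
  have hAT : ∀ x t, ¬ G.Adj (.inA x) (.inT t) := fun x t hadj =>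
    hc.A_anticomplete_T x t ((e₁ (.inl x) (.inr (.inr t))).1 hadj)
  simp only [Sum.forall, Sum.elim_inl, Sum.elim_inr, forall_and] at e₂
  rcases x with x | x | x | x | x <;> rcases y with y | y | y | y | y <;>
    simp [part, toSecond] at hxy hxL hLx ⊢ <;>
    simp [e₂, hAT, hxL, hLx, h.A_anticomplete_C, h.A_complete_B, hc.a_complete_B,
      hc.a_anticomplete_C, hc.a_anticomplete_L, hc.a_anticomplete_T, G.adj_comm _ (.inA _),
      G₂.adj_comm _ .a]

theorem IsSplitGraphUnification.isDivision (h : IsSplitGraphUnification G₁ G₂ G)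
    (hc : IsComposablePair G₁ G₂) : IsDivision G part := by
  have e₁ : ∀ i j : A ⊕ L ⊕ T, G.Adj _ _ ↔ G₁.Adj _ _ := fun i j =>
    iff_of_eq (congrArg (fun K => K.Adj i j) h.induce_ALT)
  have e₂ : ∀ i j : B ⊕ C ⊕ L ⊕ T, G.Adj _ _ ↔ G₂.Adj _ _ := fun i j =>
    iff_of_eq (congrArg (fun K => K.Adj i j) h.induce_BCLT)
  have hLL : ∀ l l', l ≠ l' → G.Adj (.inL l) (.inL l') := fun l l' hl =>
    (e₁ (.inr (.inl l)) (.inr (.inl l'))).2 (hc.L_clique l l' hl)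
  have hTT : ∀ t t', ¬ G.Adj (.inT t) (.inT t') := fun t t' ht =>
    hc.T_stable t t' ((e₁ (.inr (.inr t)) (.inr (.inr t'))).1 ht)
  have hAT : ∀ x t, ¬ G.Adj (.inA x) (.inT t) := fun x t hadj =>
    hc.A_anticomplete_T x t ((e₁ (.inl x) (.inr (.inr t))).1 hadj)
  have hLC : ∀ l z, G.Adj (.inL l) (.inC z) := fun l z =>
    (e₂ (.inr (.inr (.inl l))) (.inr (.inl z))).2 (hc.L_complete_C l z)
  have hLB : ∀ l z, G.Adj (.inL l) (.inB z) := fun l z =>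
    (e₂ (.inr (.inr (.inl l))) (.inl z)).2 (hc.L_complete_B l z)
  have hTC : ∀ t z, ¬ G.Adj (.inT t) (.inC z) := fun t z hadj =>
    hc.T_anticomplete_C t z ((e₂ (.inr (.inr (.inr t))) (.inr (.inl z))).1 hadj)
  constructor
  · rintro (x | x | x | x | x) (y | y | y | y | y) hne <;>
      simp [part, DividePart.forcesAdj] <;> first
      | exact h.A_complete_B _ _
      | exact (h.A_complete_B _ _).symm
      | exact hLL _ _ (by rintro rfl; exact hne rfl)
      | exact hLB _ _
      | exact (hLB _ _).symm
      | exact hLC _ _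
      | exact (hLC _ _).symm
  · rintro (x | x | x | x | x) (y | y | y | y | y) <;>
      simp [part, DividePart.forcesNonadj] <;> first
      | exact h.A_anticomplete_C _ _
      | exact mt G.adj_symm (h.A_anticomplete_C _ _)
      | exact hAT _ _
      | exact mt G.adj_symm (hAT _ _)
      | exact hTT _ _
      | exact hTC _ _
      | exact mt G.adj_symm (hTC _ _)

theorem IsSplitGraphUnification.isP5HouseC5Free (h : IsSplitGraphUnification G₁ G₂ G)
    (hc : IsComposablePair G₁ G₂) (h₁ : IsP5HouseC5Free G₁) (h₂ : IsP5HouseC5Free G₂) :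
    IsP5HouseC5Free G := by
  rw [isP5HouseC5Free_iff]
  rintro H hH ⟨φ⟩
  have hφ : ∀ i j, G.Adj (φ i) (φ j) ↔ H.Adj i j := fun i j => φ.map_adj_iff
  rcases ((h.isDivision hc).comap φ).obstruction hH with ⟨hA, hAL, -⟩ | ⟨hB, hC⟩
  · refine h₂.false_of_adj_iff hH (fun i => (φ i).toSecond) fun i j => ?_
    rcases eq_or_ne i j with rfl | hij
    · simp
    rw [← hφ]
    refine (h.adj_iff_second hc (fun hx => hij (hA i j hx.1 hx.2)) ?_ ?_).symm
    · exact fun hi hj => (hφ i j).not.2 (hAL i j hi hj)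
    · exact fun hi hj => (hφ j i).not.2 (hAL j i hi hj)
  · refine h₁.false_of_adj_iff hH (fun i => (φ i).toFirst) fun i j => ?_
    rcases eq_or_ne i j with rfl | hij
    · simp
    rw [← hφ]
    exact (h.adj_iff_first hc (hB i) (hB j) (fun hx => hij (hC i j hx.1 hx.2))).symm

end Unification

/-! ### Recovering a composable pair from a division -/

section Decompose

variable {V : Type u} (t : V → DividePart)

/-- The first vertex set of the parts of `t` as vertices of the whole graph, with `c₀` for `c`. -/
def firstToVertex (c₀ : V) :
    FirstVertex {x // t x = .A} {x // t x = .L} {x // t x = .T} → V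
  | .inA x => x
  | .inL x => x
  | .inT x => x
  | .c => c₀

/-- The second vertex set of the parts of `t` as vertices of the whole graph, with `a₀` for `a`. -/
def secondToVertex (a₀ : V) :
    SecondVertex {x // t x = .B} {x // t x = .C} {x // t x = .L} {x // t x = .T} → V
  | .inB x => x
  | .inC x => x
  | .inL x => x
  | .inT x => x
  | .a => a₀

/-- The disjoint union of the parts of `t` as vertices of the whole graph. -/
def unificationToVertex : UnificationVertex {x // t x = .A} {x // t x = .B} {x // t x = .C}
    {x // t x = .L} {x // t x = .T} → V
  | .inA x => x
  | .inB x => x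
  | .inC x => x
  | .inL x => x
  | .inT x => x

variable {t}

theorem firstToVertex_injective {c₀ : V} (hc : t c₀ = .C) :
    Function.Injective (firstToVertex t c₀) := by
  rintro (⟨x, hx⟩ | ⟨x, hx⟩ | ⟨x, hx⟩ | _) (⟨y, hy⟩ | ⟨y, hy⟩ | ⟨y, hy⟩ | _) h <;>
    simp only [firstToVertex] at h <;> first
    | rfl
    | subst h; first
      | rfl
      | exact absurd (hx.symm.trans hy) (by decide)
      | exact absurd (hx.symm.trans hc) (by decide)
      | exact absurd (hy.symm.trans hc) (by decide)

theorem secondToVertex_injective {a₀ : V} (ha : t a₀ = .A) :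
    Function.Injective (secondToVertex t a₀) := by
  rintro (⟨x, hx⟩ | ⟨x, hx⟩ | ⟨x, hx⟩ | ⟨x, hx⟩ | _)
    (⟨y, hy⟩ | ⟨y, hy⟩ | ⟨y, hy⟩ | ⟨y, hy⟩ | _) h <;>
    simp only [secondToVertex] at h <;> first
    | rfl
    | subst h; first
      | rfl
      | exact absurd (hx.symm.trans hy) (by decide)
      | exact absurd (hx.symm.trans ha) (by decide)
      | exact absurd (hy.symm.trans ha) (by decide)

theorem unificationToVertex_bijective : Function.Bijective (unificationToVertex t) := by
  constructor
  · rintro (⟨x, hx⟩ | ⟨x, hx⟩ | ⟨x, hx⟩ | ⟨x, hx⟩ | ⟨x, hx⟩)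
      (⟨y, hy⟩ | ⟨y, hy⟩ | ⟨y, hy⟩ | ⟨y, hy⟩ | ⟨y, hy⟩) h <;>
      simp only [unificationToVertex] at h <;> subst h <;> first
      | rfl
      | exact absurd (hx.symm.trans hy) (by decide)
  · intro x
    cases hx : t x
    · exact ⟨.inA ⟨x, hx⟩, rfl⟩
    · exact ⟨.inB ⟨x, hx⟩, rfl⟩
    · exact ⟨.inC ⟨x, hx⟩, rfl⟩
    · exact ⟨.inL ⟨x, hx⟩, rfl⟩
    · exact ⟨.inT ⟨x, hx⟩, rfl⟩

/-- The second graph of the composable pair of a division: the subgraph induced on `B`, `C`, `L`, `T`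
and a vertex `a₀` of `A`, without the edges between `a₀` and `L`. -/
def secondGraph (G : SimpleGraph V) (t : V → DividePart) (a₀ : V) :
    SimpleGraph (SecondVertex {x // t x = .B} {x // t x = .C} {x // t x = .L} {x // t x = .T}) where
  Adj x y := G.Adj (secondToVertex t a₀ x) (secondToVertex t a₀ y) ∧
    ¬ (x = .a ∧ t (secondToVertex t a₀ y) = .L) ∧ ¬ (y = .a ∧ t (secondToVertex t a₀ x) = .L)
  symm := ⟨fun _ _ h => ⟨h.1.symm, h.2.2, h.2.1⟩⟩
  loopless := ⟨fun _ h => G.irrefl h.1⟩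

theorem secondGraph_adj {G : SimpleGraph V} {a₀ : V}
    {x y : SecondVertex {x // t x = .B} {x // t x = .C} {x // t x = .L} {x // t x = .T}} :
    (secondGraph G t a₀).Adj x y ↔ G.Adj (secondToVertex t a₀ x) (secondToVertex t a₀ y) ∧
      ¬ (x = .a ∧ t (secondToVertex t a₀ y) = .L) ∧
      ¬ (y = .a ∧ t (secondToVertex t a₀ x) = .L) :=
  Iff.rfl

theorem IsDivision.part_secondToVertex {G : SimpleGraph V} (ht : IsDivision G t) {a₀ : V}
    (ha : t a₀ = .A) : IsDivision (secondGraph G t a₀) (t ∘ secondToVertex t a₀) := by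
  constructor
  · intro x y hxy hp
    refine ⟨ht.adj _ _ ((secondToVertex_injective ha).ne hxy) hp, ?_, ?_⟩
    · rintro ⟨rfl, hL⟩
      have hA : t (secondToVertex t a₀ .a) = .A := ha
      rw [Function.comp, Function.comp, hL, hA] at hp
      cases hp
    · rintro ⟨rfl, hL⟩
      have hA : t (secondToVertex t a₀ .a) = .A := ha
      rw [Function.comp, Function.comp, hL, hA] at hp
      cases hp
  · exact fun x y hp h => ht.not_adj _ _ hp h.1

theorem secondToVertex_part_eq_A {a₀ : V}
    {x : SecondVertex {x // t x = .B} {x // t x = .C} {x // t x = .L} {x // t x = .T}}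
    (hx : t (secondToVertex t a₀ x) = .A) : x = .a := by
  rcases x with ⟨x, h⟩ | ⟨x, h⟩ | ⟨x, h⟩ | ⟨x, h⟩ | _ <;> simp_all [secondToVertex]

theorem secondToVertex_eq_of_ne {a₀ a₁ : V}
    {x : SecondVertex {x // t x = .B} {x // t x = .C} {x // t x = .L} {x // t x = .T}}
    (hx : x ≠ .a) : secondToVertex t a₀ x = secondToVertex t a₁ x := by
  rcases x with ⟨x, h⟩ | ⟨x, h⟩ | ⟨x, h⟩ | ⟨x, h⟩ | _ <;> simp_all [secondToVertex]

/-- The second graph need not be an induced subgraph of `G`, because all of `L` may have no common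
nonneighbour in `A`. But an obstruction containing `a` has at most one vertex in `L`, and a
nonneighbour of that vertex can play the role of `a`. -/
theorem IsDivision.isP5HouseC5Free_secondGraph {G : SimpleGraph V} (ht : IsDivision G t)
    (hG : IsP5HouseC5Free G) {a₀ : V} (ha : t a₀ = .A)
    (hL : ∀ l, t l = .L → ∃ x, t x = .A ∧ ¬ G.Adj x l) :
    IsP5HouseC5Free (secondGraph G t a₀) := by
  rw [isP5HouseC5Free_iff]
  rintro H hH ⟨φ⟩
  have hφ : ∀ i j, (secondGraph G t a₀).Adj (φ i) (φ j) ↔ H.Adj i j :=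
    fun i j => φ.map_adj_iff
  -- It suffices to find a vertex of `A` with no neighbour among the vertices of `L` used by `φ`.
  suffices h : ∃ a₁, t a₁ = .A ∧ ∀ i, t (secondToVertex t a₀ (φ i)) = .L → (∃ j, φ j = .a) →
      ¬ G.Adj a₁ (secondToVertex t a₀ (φ i)) by
    obtain ⟨a₁, ha₁, h⟩ := h
    have hna : ∀ i j, φ i = .a → φ j ≠ .a →
        (G.Adj a₁ (secondToVertex t a₁ (φ j)) ↔ H.Adj i j) := by
      intro i j hi hj
      rw [← hφ, hi, secondToVertex_eq_of_ne (a₁ := a₀) hj]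
      have ha' : secondToVertex t a₀ .a = a₀ := rfl
      simp only [secondGraph_adj, ha', hj, false_and, not_false_eq_true, and_true, true_and]
      rcases hj' : t (secondToVertex t a₀ (φ j)) with _ | _ | _ | _ | _
      · exact absurd (secondToVertex_part_eq_A hj') hj
      · have h1 : ∀ a, t a = .A → G.Adj a (secondToVertex t a₀ (φ j)) := fun a hta =>
          ht.adj _ _ (by rintro h; rw [← h, hta] at hj'; cases hj') (by rw [hta, hj']; rfl)
        simpa [h1 a₁ ha₁] using h1 a₀ ha
      · have h1 : ∀ a, t a = .A → ¬ G.Adj a (secondToVertex t a₀ (φ j)) := fun a hta =>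
          ht.not_adj _ _ (by rw [hta, hj']; rfl)
        simpa [h1 a₁ ha₁] using h1 a₀ ha
      · simpa using h j hj' ⟨i, hi⟩
      · have h1 : ∀ a, t a = .A → ¬ G.Adj a (secondToVertex t a₀ (φ j)) := fun a hta =>
          ht.not_adj _ _ (by rw [hta, hj']; rfl)
        simpa [h1 a₁ ha₁] using h1 a₀ ha
    refine hG.false_of_adj_iff hH (fun i => secondToVertex t a₁ (φ i)) fun i j => ?_
    by_cases hi : φ i = .a <;> by_cases hj : φ j = .a
    · rw [← hφ, hi, hj]
      simp
    · rw [← hna i j hi hj, hi]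
      rfl
    · rw [H.adj_comm, ← hna j i hj hi, hj, G.adj_comm]
      rfl
    · rw [← hφ, secondToVertex_eq_of_ne (a₁ := a₀) hi, secondToVertex_eq_of_ne (a₁ := a₀) hj]
      simp [secondGraph_adj, hi, hj]
  have key : (∀ i, t (secondToVertex t a₀ (φ i)) ≠ .A) ∨ ∀ i j,
      t (secondToVertex t a₀ (φ i)) = .L → t (secondToVertex t a₀ (φ j)) = .L → i = j := by
    rcases ((ht.part_secondToVertex ha).comap φ).obstruction hH with ⟨-, -, h⟩ | ⟨hB, -⟩
    · exact h
    · -- Without `B`, the vertex `a` is isolated, but the obstructions have no isolated vertex.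
      left
      intro i hi
      have hia : φ i = .a := secondToVertex_part_eq_A hi
      rcases subsingleton_or_forall_or_exists_mixed hH (fun j => j ≠ i) with
        h | h | ⟨v, x, y, hv, hx, -, hvx, -⟩
      · have h01 : ∀ i : Fin 5, ¬ ∀ j k, j ≠ i → k ≠ i → j = k := by decide
        exact h01 i h
      · exact h i rfl
      · obtain rfl : v = i := not_not.1 hv
        rw [← hφ, hia] at hvx
        rcases hx' : t (secondToVertex t a₀ (φ x)) with _ | _ | _ | _ | _
        · rw [secondToVertex_part_eq_A hx'] at hvx
          exact (secondGraph G t a₀).irrefl hvx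
        · exact hB x hx'
        · exact ht.not_adj _ _ (by rw [hx', show t (secondToVertex t a₀ .a) = .A from ha]; rfl)
            hvx.1
        · exact hvx.2.1 ⟨rfl, hx'⟩
        · exact ht.not_adj _ _ (by rw [hx', show t (secondToVertex t a₀ .a) = .A from ha]; rfl)
            hvx.1
  rcases key with h | h
  · refine ⟨a₀, ha, fun i _ ⟨j, hj⟩ => absurd ?_ (h j)⟩
    rw [hj]
    exact ha
  · by_cases hex : ∃ i, t (secondToVertex t a₀ (φ i)) = .L
    · obtain ⟨i, hi⟩ := hex
      obtain ⟨x, hx, hxl⟩ := hL _ hi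
      exact ⟨x, hx, fun j hj _ => by rwa [h j i hj hi]⟩
    · push Not at hex
      exact ⟨a₀, ha, fun j hj => absurd hj (hex j)⟩

theorem IsDivision.isObtainedBySplitGraphUnification [Finite V] {G : SimpleGraph V}
    (ht : IsDivision G t) (hG : IsP5HouseC5Free G)
    (hA : ∃ a a', t a = .A ∧ t a' = .A ∧ a ≠ a')
    (hC : ∃ c d, t c = .C ∧ (t d = .C ∨ t d = .B) ∧ c ≠ d)
    (hL : ∀ l, t l = .L → ∃ x, t x = .A ∧ ¬ G.Adj x l) :
    IsObtainedBySplitGraphUnification (fun H => IsSmallerThan H G ∧ IsP5HouseC5Free H) G := by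
  obtain ⟨a₀, a', ha, ha', hne⟩ := hA
  obtain ⟨c₀, d, hc, hd, hcd⟩ := hC
  let f := firstToVertex t c₀
  let g := secondToVertex t a₀
  let r := unificationToVertex t
  have hf : f.Injective := firstToVertex_injective hc
  have hg : g.Injective := secondToVertex_injective ha
  refine ⟨_, _, _, _, _, inferInstance, inferInstance, inferInstance, inferInstance,
    inferInstance, G.comap f, secondGraph G t a₀, G.comap r, ?_, ⟨?_, ?_⟩, ⟨?_, ?_⟩, ?_, ?_⟩
  · have adj' : ∀ x y, x ≠ y → ∀ p q, t x = p → t y = q → p.forcesAdj q = true → G.Adj x y :=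
      fun x y hxy p q hp hq h => ht.adj x y hxy (by rwa [hp, hq])
    have nadj' : ∀ x y p q, t x = p → t y = q → p.forcesNonadj q = true → ¬ G.Adj x y :=
      fun x y p q hp hq h => ht.not_adj x y (by rwa [hp, hq])
    have ne' : ∀ {x y p q}, t x = p → t y = q → p ≠ q → x ≠ y := by
      rintro x y p q hp hq h rfl
      exact h (hp.symm.trans hq)
    constructor
    · exact ⟨a₀, ha⟩
    · exact ⟨c₀, hc⟩
    · exact fun l l' h => adj' _ _ (Subtype.coe_ne_coe.2 h) _ _ l.2 l'.2 rfl
    · exact fun l l' => nadj' _ _ _ _ l.2 l'.2 rfl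
    · exact fun l l' => nadj' _ _ _ _ l.2 l'.2 rfl
    · exact fun l => adj' _ _ (ne' hc l.2 (by decide)) _ _ hc l.2 rfl
    · exact fun l => nadj' _ _ _ _ hc l.2 rfl
    · exact fun l => nadj' _ _ _ _ hc l.2 rfl
    · ext (x | x) (y | y) <;> simp [secondGraph_adj, secondToVertex, f, firstToVertex]
    · exact fun x y h => nadj' _ _ _ _ x.2 y.2 rfl h.1
    · exact fun x y => ⟨adj' _ _ (ne' x.2 y.2 (by decide)) _ _ x.2 y.2 rfl, by simp, by simp⟩
    · exact fun x y => ⟨adj' _ _ (ne' x.2 y.2 (by decide)) _ _ x.2 y.2 rfl, by simp, by simp⟩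
    · exact fun y => ⟨adj' _ _ (ne' ha y.2 (by decide)) _ _ ha y.2 rfl,
        by simp [secondToVertex, y.2], by simp⟩
    · exact fun y h => nadj' _ _ _ _ ha y.2 rfl h.1
    · exact fun y h => h.2.1 ⟨rfl, y.2⟩
    · exact fun y h => nadj' _ _ _ _ ha y.2 rfl h.1
  · have hd' : d ∉ Set.range f := by
      rintro ⟨⟨x, h⟩ | ⟨x, h⟩ | ⟨x, h⟩ | _, hx⟩ <;> simp only [f, firstToVertex] at hx <;>
        simp_all
    have := Fintype.ofFinite V
    have := Fintype.ofInjective f hf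
    simpa [IsSmallerThan, Nat.card_eq_fintype_card] using
      Fintype.card_lt_of_injective_of_notMem f hf hd'
  · exact hG.of_embedding ⟨⟨f, hf⟩, Iff.rfl⟩
  · have hd' : a' ∉ Set.range g := by
      rintro ⟨⟨x, h⟩ | ⟨x, h⟩ | ⟨x, h⟩ | ⟨x, h⟩ | _, hx⟩ <;>
        simp only [g, secondToVertex] at hx <;> simp_all
    have := Fintype.ofFinite V
    have := Fintype.ofInjective g hg
    simpa [IsSmallerThan, Nat.card_eq_fintype_card] using
      Fintype.card_lt_of_injective_of_notMem g hg hd'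
  · exact ht.isP5HouseC5Free_secondGraph hG ha hL
  · constructor
    · ext (x | x | x) (y | y | y) <;> rfl
    · ext (x | x | x | x) (y | y | y | y) <;>
        simp [secondGraph_adj, secondToVertex, r, unificationToVertex]
    · exact fun x y => ht.adj _ _
        (fun h => by have := x.2; have := y.2; simp_all [r, unificationToVertex])
        (by simp [r, unificationToVertex, x.2, y.2, DividePart.forcesAdj])
    · exact fun x y => ht.not_adj _ _
        (by simp [r, unificationToVertex, x.2, y.2, DividePart.forcesNonadj])
  · exact ⟨(⟨Equiv.ofBijective r unificationToVertex_bijective, Iff.rfl⟩ : G.comap r ≃g G).symm⟩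

end Decompose

/-! ### Connected sets -/

section ConnectedSets

variable {V : Type*} {G : SimpleGraph V}

/-- The set `D` induces a connected subgraph (or is empty), expressed by cuts: every nonempty proper
subset of `D` has an edge to its complement in `D`. -/
def IsConnectedSet (G : SimpleGraph V) (D : Set V) : Prop :=
  ∀ S ⊆ D, S.Nonempty → S ≠ D → ∃ x ∈ S, ∃ y ∈ D \ S, G.Adj x y

theorem IsConnectedSet.insert {D : Set V} (hD : IsConnectedSet G D) {v w : V} (hw : w ∈ D)
    (hvw : G.Adj v w) : IsConnectedSet G (insert v D) := by
  intro S hS hne hSD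
  by_cases hvD : v ∈ D
  · rw [Set.insert_eq_of_mem hvD] at hS hSD ⊢
    exact hD S hS hne hSD
  have h1 : S ∩ D = D → S = D := by
    intro h
    have hvS : v ∉ S := fun hv => hSD (hS.antisymm (Set.insert_subset hv (Set.inter_eq_right.1 h)))
    refine Set.Subset.antisymm (fun x hx => (hS hx).resolve_left ?_) (Set.inter_eq_right.1 h)
    rintro rfl
    exact hvS hx
  rcases (S ∩ D).eq_empty_or_nonempty with h0 | h0
  · obtain ⟨x, hx⟩ := hne
    have hxv : x = v := (hS hx).resolve_right fun h => (h0.subset ⟨hx, h⟩).elim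
    subst hxv
    exact ⟨x, hx, w, ⟨.inr hw, fun h => (h0.subset ⟨h, hw⟩).elim⟩, hvw⟩
  · by_cases h2 : S ∩ D = D
    · rw [h1 h2]
      exact ⟨w, hw, v, ⟨.inl rfl, hvD⟩, hvw.symm⟩
    · obtain ⟨x, hx, y, hy, hxy⟩ := hD (S ∩ D) Set.inter_subset_right h0 h2
      exact ⟨x, hx.1, y, ⟨.inr hy.1, fun h => hy.2 ⟨h, hy.1⟩⟩, hxy⟩

theorem isConnectedSet_singleton (v : V) : IsConnectedSet G {v} := by
  intro S hS hne hSD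
  exact absurd ((Set.subset_singleton_iff_eq.1 hS).resolve_left hne.ne_empty) hSD

theorem isConnectedSet_pair {v w : V} (h : G.Adj v w) : IsConnectedSet G {v, w} :=
  (isConnectedSet_singleton w).insert rfl h

theorem isConnectedSet_insert_of_forall_adj {D : Set V} {v : V} (h : ∀ x ∈ D, G.Adj v x) :
    IsConnectedSet G (insert v D) := by
  intro S hS ⟨x, hx⟩ hSD
  by_cases hv : v ∈ S
  · obtain ⟨y, hy, hyS⟩ : ∃ y ∈ D, y ∉ S := by
      by_contra! hDS
      exact hSD (hS.antisymm (Set.insert_subset hv hDS))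
    exact ⟨v, hv, y, ⟨.inr hy, hyS⟩, h y hy⟩
  · have hxD : x ∈ D := (hS hx).resolve_left (by rintro rfl; exact hv hx)
    exact ⟨x, hx, v, ⟨.inl rfl, hv⟩, (h x hxD).symm⟩

theorem IsConnectedSet.exists_mixed_edge {D : Set V} (hD : IsConnectedSet G D) {s x y : V}
    (hx : x ∈ D) (hy : y ∈ D) (hsx : G.Adj s x) (hsy : ¬ G.Adj s y) :
    ∃ p ∈ D, ∃ q ∈ D, G.Adj p q ∧ G.Adj s p ∧ ¬ G.Adj s q := by
  obtain ⟨p, hp, q, hq, hpq⟩ := hD {z ∈ D | G.Adj s z} (Set.sep_subset _ _) ⟨x, hx, hsx⟩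
    (fun h => hsy (h.symm.subset hy).2)
  exact ⟨p, hp.1, q, hq.1, hpq, hp.2, fun h => hq.2 ⟨hq.1, h⟩⟩

end ConnectedSets

/-- `A` is a connected set with at least two vertices such that some edge `c d` of `G` is anticomplete
to `A`. That `c` and `d` lie outside `A` follows, since they are adjacent. -/
structure IsSeparatedCore {V : Type*} (G : SimpleGraph V) (A : Set V) : Prop where
  connected : IsConnectedSet G A
  nontrivial : A.Nontrivial
  exists_far_edge : ∃ c d, G.Adj c d ∧ ∀ x ∈ A, ¬ G.Adj x c ∧ ¬ G.Adj x d

/-! ### The division of a separated core of maximum size -/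

section Divide

variable {V : Type u} {G : SimpleGraph V}

/-- If `D` is connected and anticomplete to `a`, then two nonadjacent neighbours of `a` that attach to
`D` have a common neighbour in `D`: otherwise there is an induced `P₅` or `C₅`. -/
theorem IsP5HouseC5Free.exists_common_neighbor (hG : IsP5HouseC5Free G) {D : Set V}
    (hD : IsConnectedSet G D) {a l m : V} (ha : ∀ x ∈ D, ¬ G.Adj a x) (hal : G.Adj a l)
    (ham : G.Adj a m) (hlm : ¬ G.Adj l m) (hl : ∃ x ∈ D, G.Adj l x) (hm : ∃ x ∈ D, G.Adj m x) :
    ∃ x ∈ D, G.Adj l x ∧ G.Adj m x := by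
  by_contra! hno
  obtain ⟨y, hy, hmy⟩ := hm
  -- By `P₅`-freeness every vertex of `D` is a neighbour of `l` or adjacent to one.
  have hS : {z ∈ D | G.Adj l z ∨ ∃ x ∈ D, G.Adj l x ∧ G.Adj x z} = D := by
    by_contra hne
    obtain ⟨x₀, hx₀, hlx₀⟩ := hl
    obtain ⟨z, ⟨hz, hz'⟩, w, ⟨hw, hw'⟩, hzw⟩ := hD _ (Set.sep_subset _ _)
      ⟨x₀, hx₀, .inl hlx₀⟩ hne
    simp only [Set.mem_ofPred_eq, hw, true_and, not_or, not_exists, not_and] at hw'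
    have hlz : ¬ G.Adj l z := fun h => hw'.2 z hz h hzw
    obtain ⟨x, hx, hlx, hxz⟩ := hz'.resolve_left hlz
    exact hG.false_of_path hal hlx hxz hzw (ha x hx) (ha z hz) (ha w hw) hlz hw'.1
      (hw'.2 x hx hlx)
  obtain ⟨-, h⟩ := hS.symm.subset hy
  have hly : ¬ G.Adj l y := fun h => hno y hy h hmy
  obtain ⟨x, hx, hlx, hxy⟩ := h.resolve_left hly
  exact hG.false_of_cycle hal hlx hxy hmy.symm ham.symm (ha x hx) (ha y hy) hly hlm
    (fun h => hno x hx hlx h.symm)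

/-- A separated core `A` that is largest over both `G` and its complement yields a division. Its part
`A` is not the core itself but a component `D` of the subgraph far from the core, `L` consists of the
attachments of the core that are mixed on `D`, and `B` of the other attachments. -/
theorem IsSeparatedCore.exists_divide [Finite V] (hG : IsP5HouseC5Free G) {A : Set V}
    (hA : IsSeparatedCore G A)
    (hmax : ∀ A', IsSeparatedCore G A' ∨ IsSeparatedCore Gᶜ A' → A'.ncard ≤ A.ncard) :
    ∃ t : V → DividePart, IsDivision G t ∧ (∃ a a', t a = .A ∧ t a' = .A ∧ a ≠ a') ∧
      (∃ c d, t c = .C ∧ (t d = .C ∨ t d = .B) ∧ c ≠ d) ∧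
      ∀ l, t l = .L → ∃ x, t x = .A ∧ ¬ G.Adj x l := by
  classical
  have hins : ∀ v ∉ A, ¬ (insert v A).ncard ≤ A.ncard := fun v hv => by
    rw [Set.ncard_insert_of_notMem hv]; omega
  -- `R` is the set of vertices outside `A` without a neighbour in `A`.
  let R : Set V := {x | x ∉ A ∧ ∀ a ∈ A, ¬ G.Adj a x}
  obtain ⟨c₀, d₀, hcd, hfar⟩ := hA.exists_far_edge
  have hcA : c₀ ∉ A := fun h => (hfar c₀ h).2 hcd
  have hdA : d₀ ∉ A := fun h => (hfar d₀ h).1 hcd.symm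
  have hc₀ : c₀ ∈ R := ⟨hcA, fun a ha => (hfar a ha).1⟩
  have hd₀ : d₀ ∈ R := ⟨hdA, fun a ha => (hfar a ha).2⟩
  -- `D` is the component of `G[R]` that contains the edge `c₀ d₀`.
  obtain ⟨D, ⟨hDR, hDc, hcD, hdD⟩, hDmax⟩ := Set.exists_max_image
    {D : Set V | D ⊆ R ∧ IsConnectedSet G D ∧ c₀ ∈ D ∧ d₀ ∈ D} Set.ncard (Set.toFinite _)
    ⟨{c₀, d₀}, Set.insert_subset hc₀ (Set.singleton_subset_iff.2 hd₀), isConnectedSet_pair hcd,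
      .inl rfl, .inr rfl⟩
  have hDR' : ∀ x ∈ R, x ∉ D → ∀ y ∈ D, ¬ G.Adj x y := by
    intro x hx hxD y hy hxy
    have := hDmax (insert x D) ⟨Set.insert_subset hx hDR, hDc.insert hy hxy, .inr hcD, .inr hdD⟩
    rw [Set.ncard_insert_of_notMem hxD] at this
    omega
  have hDA : ∀ x ∈ D, x ∉ A := fun x hx => (hDR hx).1
  have hAD : ∀ a ∈ A, ∀ x ∈ D, ¬ G.Adj a x := fun a ha x hx => (hDR hx).2 a ha
  -- Maximality: a vertex `s` attached to `A` meets every edge of `G[R]`.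
  have hmeet : ∀ s ∉ A, s ∉ R → ∀ x ∈ R, ∀ y ∈ R, G.Adj x y → G.Adj s x ∨ G.Adj s y := by
    intro s hs hsR x hx y hy hxy
    by_contra! h
    obtain ⟨a, ha, has⟩ : ∃ a ∈ A, G.Adj a s := by
      by_contra! h'
      exact hsR ⟨hs, h'⟩
    refine hins s hs (hmax _ (.inl ⟨hA.connected.insert ha has.symm,
      hA.nontrivial.mono (Set.subset_insert _ _), x, y, hxy, ?_⟩))
    rintro z (rfl | hz)
    · exact h
    · exact ⟨hx.2 z hz, hy.2 z hz⟩
  -- The parts: `N` is the set of attachments of `A`, `M` the ones mixed on `D`.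
  let N : Set V := {s | s ∉ A ∧ s ∉ R}
  let M : Set V := {s ∈ N | ∃ x ∈ D, ¬ G.Adj s x}
  have hND : ∀ s ∈ N, ∃ x ∈ D, G.Adj s x := by
    intro s hs
    rcases hmeet s hs.1 hs.2 c₀ hc₀ d₀ hd₀ hcd with h | h
    exacts [⟨c₀, hcD, h⟩, ⟨d₀, hdD, h⟩]
  have hNA : ∀ s ∈ N, ∃ a ∈ A, G.Adj a s := by
    intro s hs
    by_contra! h
    exact hs.2 ⟨hs.1, h⟩
  have hMedge : ∀ s ∈ M, ∃ p ∈ D, ∃ q ∈ D, G.Adj p q ∧ G.Adj s p ∧ ¬ G.Adj s q := by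
    rintro s ⟨hsN, y, hy, hsy⟩
    obtain ⟨x, hx, hsx⟩ := hND s hsN
    exact hDc.exists_mixed_edge hx hy hsx hsy
  -- Otherwise a mixed edge of `D`, `s` and the edge `x y` form a `P₅`.
  have hMpath : ∀ s ∈ M, ∀ x y, G.Adj x y → (∀ z ∈ D, ¬ G.Adj x z) → (∀ z ∈ D, ¬ G.Adj y z) →
      G.Adj s x → G.Adj s y := by
    intro s hs x y hxy hx hy hsx
    by_contra hsy
    obtain ⟨p, hp, q, hq, hpq, hsp, hsq⟩ := hMedge s hs
    exact hG.false_of_path hpq.symm hsp.symm hsx hxy (mt G.adj_symm hsq) (mt G.adj_symm (hx q hq))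
      (mt G.adj_symm (hy q hq)) (mt G.adj_symm (hx p hp)) (mt G.adj_symm (hy p hp)) hsy
  have hMA : ∀ s ∈ M, ∀ a ∈ A, G.Adj s a := by
    intro s hs a ha
    by_contra hsa
    obtain ⟨a', ha', has'⟩ := hNA s hs.1
    obtain ⟨p, hp, q, hq, hpq, hsp, hsq⟩ := hA.connected.exists_mixed_edge ha' ha has'.symm hsa
    exact hsq (hMpath s hs p q hpq (hAD p hp) (hAD q hq) hsp)
  have hMR : ∀ s ∈ M, ∀ x ∈ R, x ∉ D → (∃ y ∈ R, y ∉ D ∧ G.Adj x y) → G.Adj s x := by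
    rintro s hs x hx hxD ⟨y, hy, hyD, hxy⟩
    rcases hmeet s hs.1.1 hs.1.2 x hx y hy hxy with h | h
    · exact h
    · exact hMpath s hs y x hxy.symm (hDR' y hy hyD) (hDR' x hx hxD) h
  have hMN : ∀ s ∈ M, ∀ b ∈ N, b ∉ M → G.Adj s b := by
    intro s hs b hb hbM
    have hbD : ∀ x ∈ D, G.Adj b x := by
      by_contra! h
      exact hbM ⟨hb, h⟩
    by_contra hsb
    obtain ⟨p, hp, q, hq, hpq, hsp, hsq⟩ := hMedge s hs
    obtain ⟨a, ha, hab⟩ := hNA b hb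
    -- `s p b a` is a four-cycle and `q` is the roof of a house on the edge `p b`.
    exact hG.false_of_house (mt G.adj_symm hsb) hsq (mt G.adj_symm (hAD a ha q hq))
      (hAD a ha p hp) (hbD q hq) hab.symm (hbD p hp) (hMA s hs a ha) hsp hpq.symm
  have hMclique : ∀ s ∈ M, ∀ s' ∈ M, s ≠ s' → G.Adj s s' := by
    intro s hs s' hs' hne
    by_contra hss
    obtain ⟨a, ha⟩ := hA.nontrivial.nonempty
    obtain ⟨c, hc, hsc, hsc'⟩ := hG.exists_common_neighbor hDc (hAD a ha) (hMA s hs a ha).symm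
      (hMA s' hs' a ha).symm hss (hND s hs.1) (hND s' hs'.1)
    -- In the complement, `A ∪ {c}` is connected and anticomplete to the edge `s s'`.
    refine hins c (hDA c hc) (hmax _ (.inr ⟨isConnectedSet_insert_of_forall_adj fun x hx => ?_,
      hA.nontrivial.mono (Set.subset_insert _ _), s, s', ?_, ?_⟩))
    · rw [compl_adj]
      exact ⟨by rintro rfl; exact hDA _ hc hx, mt G.adj_symm (hAD x hx c hc)⟩
    · exact (compl_adj _ _ _).2 ⟨hne, hss⟩
    · rintro z (rfl | hz)
      · simp [compl_adj, hsc.symm, hsc'.symm]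
      · simp [compl_adj, (hMA s hs z hz).symm, (hMA s' hs' z hz).symm]
  -- `C` consists of the core and of the other vertices of `R` outside `D` that are not isolated
  -- there, `T` of the isolated ones.
  let t : V → DividePart := fun x =>
    if x ∈ D then .A else if x ∈ M then .L else if x ∈ N then .B
    else if x ∈ A ∨ ∃ y ∈ R, y ∉ D ∧ G.Adj x y then .C else .T
  have hNot : ∀ x, x ∉ N → x ∈ A ∨ x ∈ R := by
    intro x hx
    by_contra! h
    exact hx h
  have tA : ∀ x, t x = .A → x ∈ D := by
    intro x hx
    simp only [t] at hx
    split_ifs at hx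
    assumption
  have tL : ∀ x, t x = .L → x ∈ M := by
    intro x hx
    simp only [t] at hx
    split_ifs at hx
    assumption
  have tB : ∀ x, t x = .B → x ∈ N ∧ x ∉ M := by
    intro x hx
    simp only [t] at hx
    split_ifs at hx
    exact ⟨by assumption, by assumption⟩
  have tC : ∀ x, t x = .C → x ∈ A ∨ x ∈ R ∧ x ∉ D ∧ ∃ y ∈ R, y ∉ D ∧ G.Adj x y := by
    intro x hx
    simp only [t] at hx
    split_ifs at hx with h1 h2 h3 h4
    rcases h4 with h4 | h4
    · exact .inl h4
    · exact (hNot x h3).imp_right fun h => ⟨h, h1, h4⟩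
  have tT : ∀ x, t x = .T → x ∈ R ∧ x ∉ D ∧ ∀ y ∈ R, y ∉ D → ¬ G.Adj x y := by
    intro x hx
    simp only [t] at hx
    split_ifs at hx with h1 h2 h3 h4
    push Not at h4
    exact ⟨(hNot x h3).resolve_left h4.1, h1, h4.2⟩
  have hAB : ∀ x y, t x = .A → t y = .B → G.Adj x y := by
    intro x y hx hy
    by_contra h
    exact (tB y hy).2 ⟨(tB y hy).1, x, tA x hx, mt G.adj_symm h⟩
  have hLC : ∀ x y, t x = .L → t y = .C → G.Adj x y := by
    intro x y hx hy
    rcases tC y hy with h | ⟨h, hD, h'⟩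
    exacts [hMA x (tL x hx) y h, hMR x (tL x hx) y h hD h']
  have hLB : ∀ x y, t x = .L → t y = .B → G.Adj x y := fun x y hx hy =>
    hMN x (tL x hx) y (tB y hy).1 (tB y hy).2
  have hCA : ∀ x y, t x = .C → t y = .A → ¬ G.Adj x y := by
    intro x y hx hy
    rcases tC x hx with h | ⟨h, hD, -⟩
    exacts [hAD x h y (tA y hy), hDR' x h hD y (tA y hy)]
  have hTA : ∀ x y, t x = .T → t y = .A → ¬ G.Adj x y := fun x y hx hy =>
    hDR' x (tT x hx).1 (tT x hx).2.1 y (tA y hy)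
  have hTC : ∀ x y, t x = .T → t y = .C → ¬ G.Adj x y := by
    intro x y hx hy
    rcases tC y hy with h | ⟨h, hD, -⟩
    exacts [mt G.adj_symm ((tT x hx).1.2 y h), (tT x hx).2.2 y h hD]
  have htA : ∀ x ∈ A, t x = .C := by
    intro x hx
    have h1 : x ∉ D := fun h => hDA x h hx
    have h2 : x ∉ N := fun h => h.1 hx
    have h3 : x ∉ M := fun h => h2 h.1
    simp [t, h1, h2, h3, hx]
  have htD : ∀ x ∈ D, t x = .A := fun x hx => if_pos hx
  refine ⟨t, ⟨fun x y hxy h => ?_, fun x y h => ?_⟩, ⟨c₀, d₀, htD _ hcD, htD _ hdD, hcd.ne⟩,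
    ?_, ?_⟩
  · rcases hx : t x <;> rcases hy : t y <;> rw [hx, hy] at h <;> cases h
    · exact hAB x y hx hy
    · exact (hAB y x hy hx).symm
    · exact (hLB y x hy hx).symm
    · exact (hLC y x hy hx).symm
    · exact hLB x y hx hy
    · exact hLC x y hx hy
    · exact hMclique x (tL x hx) y (tL y hy) hxy
  · rcases hx : t x <;> rcases hy : t y <;> rw [hx, hy] at h <;> cases h
    · exact mt G.adj_symm (hCA y x hy hx)
    · exact mt G.adj_symm (hTA y x hy hx)
    · exact hCA x y hx hy
    · exact mt G.adj_symm (hTC y x hy hx)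
    · exact hTA x y hx hy
    · exact hTC x y hx hy
    · exact (tT x hx).2.2 y (tT y hy).1 (tT y hy).2.1
  · obtain ⟨x, hx, y, hy, hne⟩ := hA.nontrivial
    exact ⟨x, y, htA x hx, .inl (htA y hy), hne⟩
  · intro l hl
    obtain ⟨-, x, hx, hlx⟩ := tL l hl
    exact ⟨x, htD x hx, mt G.adj_symm hlx⟩

end Divide

/-! ### Split graphs -/

section Split

variable {V : Type u} {G : SimpleGraph V}

/-- A graph without induced `2K₂`, `C₄` and `C₅` is split (Földes and Hammer). -/
theorem isSplitGraph_of_forall [Finite V]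
    (h2 : ∀ a b c d, G.Adj a b → G.Adj c d → G.Adj a c ∨ G.Adj a d ∨ G.Adj b c ∨ G.Adj b d)
    (h4 : ∀ a b c d, a ≠ c → b ≠ d → G.Adj a b → G.Adj b c → G.Adj c d → G.Adj d a →
      G.Adj a c ∨ G.Adj b d)
    (h5 : ∀ a b c d e, G.Adj a b → G.Adj b c → G.Adj c d → G.Adj d e → G.Adj e a →
      ¬ G.Adj a c → ¬ G.Adj a d → ¬ G.Adj b d → ¬ G.Adj b e → ¬ G.Adj c e → False) :
    IsSplitGraph G := by
  classical
  have := Fintype.ofFinite V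
  -- Among the cliques of maximum size choose one whose degree sum is maximum.
  obtain ⟨K₀, hK₀, hK₀max⟩ := Finset.exists_max_image
    (Finset.univ.filter fun K : Finset V => G.IsClique (K : Set V)) Finset.card ⟨∅, by simp⟩
  obtain ⟨K, hK, hKmax⟩ := Finset.exists_max_image
    (Finset.univ.filter fun K : Finset V => G.IsClique (K : Set V) ∧ K.card = K₀.card)
    (fun K => ∑ v ∈ K, G.degree v) ⟨K₀, by simpa using hK₀⟩
  simp only [Finset.mem_filter, Finset.mem_univ, true_and] at hK₀max hK hKmax
  obtain ⟨hKc, hKcard⟩ := hK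
  rw [← hKcard] at hK₀max hKmax
  refine ⟨K, (K : Set V)ᶜ, Set.union_compl_self _, disjoint_compl_right, hKc, ?_⟩
  rintro x hx y hy - hxy
  simp only [Set.mem_compl_iff, Finset.mem_coe] at hx hy
  have hnon : ∀ x ∉ K, ∃ u ∈ K, ¬ G.Adj x u := by
    intro x hx
    by_contra! h
    have := hK₀max (insert x K) (by
      rw [Finset.coe_insert]
      exact hKc.insert fun u hu _ => h u hu)
    rw [Finset.card_insert_of_notMem hx] at this
    omega
  have hadj : ∀ u ∈ K, ∀ v ∈ K, u ≠ v → G.Adj u v := fun u hu v hv h => hKc hu hv h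
  -- Nonneighbours of `x` and of `y` in `K` are nested, for otherwise there is a four-cycle.
  wlog hsub : ∀ u ∈ K, ¬ G.Adj x u → ¬ G.Adj y u generalizing x y
  · refine this hxy.symm hy hx (fun v hv hyv hxv => hsub fun u hu hxu hyu => ?_)
    have huv : u ≠ v := by rintro rfl; exact hxu hxv
    rcases h4 x v u y (by rintro rfl; exact hx hu) (by rintro rfl; exact hy hv) hxv
      (hadj v hv u hu huv.symm) hyu.symm hxy.symm with h | h
    exacts [hxu h, hyv h.symm]
  obtain ⟨u, hu, hxu⟩ := hnon x hx
  have hyu := hsub u hu hxu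
  have hxK : ∀ v ∈ K, v ≠ u → G.Adj x v := by
    intro v hv hvu
    by_contra hxv
    rcases h2 x y u v hxy (hadj u hu v hv hvu.symm) with h | h | h | h
    exacts [hxu h, hxv h, hyu h, hsub v hv hxv h]
  have hxne : ∀ v ∈ K, x ≠ v := by rintro v hv rfl; exact hx hv
  have hyne : ∀ v ∈ K, y ≠ v := by rintro v hv rfl; exact hy hv
  have hswap : G.IsClique (insert x (K.erase u) : Finset V) := by
    rw [Finset.coe_insert]
    refine (hKc.subset (by simp)).insert fun v hv _ => ?_
    rw [Finset.mem_coe, Finset.mem_erase] at hv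
    exact hxK v hv.2 hv.1
  have hxe : x ∉ K.erase u := fun h => hx (Finset.mem_of_mem_erase h)
  have hcard : (insert x (K.erase u)).card = K.card := by
    rw [Finset.card_insert_of_notMem hxe, Finset.card_erase_add_one hu]
  obtain ⟨v, hv, hvu, hyv⟩ : ∃ v ∈ K, v ≠ u ∧ ¬ G.Adj y v := by
    by_contra! h
    have hye : y ∉ insert x (K.erase u) := by
      simp [hxy.ne', hy]
    have := hK₀max (insert y (insert x (K.erase u))) (by
      rw [Finset.coe_insert]
      refine hswap.insert fun v hv _ => ?_
      rw [Finset.mem_coe, Finset.mem_insert, Finset.mem_erase] at hv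
      rcases hv with rfl | hv
      exacts [hxy.symm, h v hv.2 hv.1])
    rw [Finset.card_insert_of_notMem hye] at this
    omega
  -- Exchanging `u` for `x` gives another maximum clique, so the degree sum cannot grow.
  have hdeg : G.degree x ≤ G.degree u := by
    have := hKmax _ ⟨hswap, hcard⟩
    rw [Finset.sum_insert hxe, ← Finset.add_sum_erase _ _ hu] at this
    omega
  -- `y` is adjacent to `x` but not to `u`, so the degrees force a vertex `w` the other way round.
  obtain ⟨w, huw, hxw⟩ : ∃ w, G.Adj u w ∧ ¬ G.Adj x w := by
    by_contra! h
    have : G.neighborFinset u ⊂ G.neighborFinset x := by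
      refine ⟨fun w hw => ?_, fun hle => ?_⟩
      · simpa using h w (by simpa using hw)
      · have := hle (show y ∈ G.neighborFinset x by simpa using hxy)
        rw [mem_neighborFinset] at this
        exact hyu this.symm
    have := Finset.card_lt_card this
    simp only [card_neighborFinset_eq_degree] at this
    omega
  have hyw : G.Adj y w := by
    rcases h2 x y u w hxy huw with h | h | h | h
    exacts [absurd h hxu, absurd h hxw, absurd h hyu, h]
  have hxv := hxK v hv hvu
  by_cases hvw : G.Adj v w
  · rcases h4 x y w v (by rintro rfl; exact hxu huw.symm) (hyne v hv) hxy hyw hvw.symm hxv.symm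
      with h | h
    exacts [hxw h, hyv h]
  · exact h5 x y w u v hxy hyw huw.symm (hadj u hu v hv hvu.symm) hxv.symm hxw hxu hyu hyv
      (mt G.adj_symm hvw)

theorem IsP5HouseC5Free.exists_isSeparatedCore [Finite V] (hG : IsP5HouseC5Free G)
    (hs : ¬ IsSplitGraph G) :
    ∃ A, IsSeparatedCore G A ∨ IsSeparatedCore Gᶜ A := by
  by_contra! hno
  refine hs (isSplitGraph_of_forall (fun a b c d hab hcd => ?_)
    (fun a b c d hac hbd hab hbc hcd hda => ?_)
    (fun a b c d e hab hbc hcd hde hea hac had hbd hbe hce =>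
      hG.false_of_cycle hab hbc hcd hde hea hac had hbd hbe hce))
  · by_contra! h
    refine (hno {a, b}).1 ⟨isConnectedSet_pair hab, Set.nontrivial_pair hab.ne, c, d, hcd, ?_⟩
    rintro x (rfl | rfl)
    exacts [⟨h.1, h.2.1⟩, ⟨h.2.2.1, h.2.2.2⟩]
  · by_contra! h
    refine (hno {a, c}).2 ⟨isConnectedSet_pair ?_, Set.nontrivial_pair hac, b, d, ?_, ?_⟩
    · exact (compl_adj _ _ _).2 ⟨hac, h.1⟩
    · exact (compl_adj _ _ _).2 ⟨hbd, h.2⟩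
    · rintro x (rfl | rfl)
      · simp [compl_adj, hab, hda.symm]
      · simp [compl_adj, hbc.symm, hcd]

theorem IsSeparatedCore.isObtainedBySplitGraphUnification [Finite V] (hG : IsP5HouseC5Free G)
    {A : Set V} (hA : IsSeparatedCore G A)
    (hmax : ∀ A', IsSeparatedCore G A' ∨ IsSeparatedCore Gᶜ A' → A'.ncard ≤ A.ncard) :
    IsObtainedBySplitGraphUnification (fun H => IsSmallerThan H G ∧ IsP5HouseC5Free H) G := by
  obtain ⟨t, ht, h1, h2, h3⟩ := hA.exists_divide hG hmax
  exact ht.isObtainedBySplitGraphUnification hG h1 h2 h3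

theorem IsSplitGraph.isP5HouseC5Free (hs : IsSplitGraph G) : IsP5HouseC5Free G := by
  obtain ⟨K, S, hKS, -, hK, hS⟩ := hs
  rw [isP5HouseC5Free_iff]
  rintro H hH ⟨φ⟩
  have hφ : ∀ i j, G.Adj (φ i) (φ j) ↔ H.Adj i j := fun i j => φ.map_adj_iff
  have hKS' : ∀ x, x ∉ K → x ∈ S := fun x hx =>
    ((hKS.symm.subset (Set.mem_univ x) : x ∈ K ∪ S)).resolve_left hx
  obtain ⟨i, j, ⟨hi, hj, hij, h⟩ | ⟨hi, hj, h⟩⟩ := exists_not_split hH (fun i => φ i ∈ K)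
  · exact h ((hφ i j).1 (hK hi hj (φ.injective.ne hij)))
  · exact hS (hKS' _ hi) (hKS' _ hj) (φ.injective.ne h.ne) ((hφ i j).2 h)

end Split

theorem theorem5p3 {V : Type u} [Finite V] (G : SimpleGraph V) :
    IsP5HouseC5Free G ↔
      IsSplitGraph G ∨
      IsObtainedBySubstitution (fun H => IsSmallerThan H G ∧ IsP5HouseC5Free H) G ∨
      IsObtainedBySplitGraphUnification (fun H => IsSmallerThan H G ∧ IsP5HouseC5Free H) G ∨
      IsObtainedBySplitGraphUnification (fun H => IsSmallerThan H G ∧ IsP5HouseC5Free H) Gᶜ := by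
  have hunif : ∀ {G' : SimpleGraph V}, IsObtainedBySplitGraphUnification
      (fun H => IsSmallerThan H G ∧ IsP5HouseC5Free H) G' → IsP5HouseC5Free G' := by
    rintro G' ⟨A, B, C, L, T, -, -, -, -, -, G₁, G₂, H, hc, h₁, h₂, hH, ⟨e⟩⟩
    exact (hH.isP5HouseC5Free hc h₁.2 h₂.2).of_embedding e.toEmbedding
  constructor
  · intro hG
    by_cases hs : IsSplitGraph G
    · exact .inl hs
    obtain ⟨A, hA, hmax⟩ := Set.exists_max_image
      {A : Set V | IsSeparatedCore G A ∨ IsSeparatedCore Gᶜ A} Set.ncard (Set.toFinite _)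
      (hG.exists_isSeparatedCore hs)
    rcases hA with hA | hA
    · exact .inr (.inr (.inl (hA.isObtainedBySplitGraphUnification hG hmax)))
    · refine .inr (.inr (.inr (hA.isObtainedBySplitGraphUnification hG.compl fun A' hA' => ?_)))
      rw [compl_compl] at hA'
      exact hmax A' hA'.symm
  · rintro (hs | ⟨V₁, V₂, -, -, G₁, G₂, u, h₁, h₂, ⟨e⟩⟩ | h | h)
    · exact hs.isP5HouseC5Free
    · exact (isP5HouseC5Free_substituteGraph h₁.2 h₂.2 u).of_embedding e.toEmbedding
    · exact hunif h
    · simpa using (hunif h).compl
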